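/- Let $X=(X,d,\mu)$ be a separable metric measure space, i.e. a separable metric space with a Borel regular outer measure $\mu$ for which every ball has positive and finite measure. Let $L^0(X)$ be the set of measurable $u:X\to[-\infty,\infty]$ with $|u|<\infty$ a.e. Median and basis. For $0<\gamma<1$, measurable $f$ and measurable $A$ with $\mu(A)<\infty$, let $m^\gamma_f(A)=\inf\{a\in\mathbb R:\mu(\{x\in A:f(x)>a\})<\gamma\mu(A)\}$. A Busemann–Feller basis is a collection $\mathcal B=\bigcup_{x\in X}\mathcal B(x)$ where each $\mathcal B(x)$ consists of bounded open sets containing $x$ and has members of arbitrarily small diameter, and $x\in B\in\mathcal B$ implies $B\in\mathcal B(x)$. Let $\mathcal M^\gamma_{\mathcal B}u(x)=\sup_{x\in B\in\mathcal B}m^\gamma_{|u|}(B)$, and let $\lim_{\mathcal B\ni B\to x}m^\gamma_u(B)$ denote the common value (if they coincide) of $\lim_{\varepsilon\to0}\sup\{m^\gamma_u(B):B\in\mathcal B(x),\ \operatorname{diam}B<\varepsilon\}$ and $\lim_{\varepsilon\to0}\inf\{m^\gamma_u(B):B\in\mathcal B(x),\ \operatorname{diam}B<\varepsilon\}$. Function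 spaces. A sequence $(g_k)_{k\in\mathbb Z}$ of nonnegative measurable functions is a fractional $s$-gradient of $u\in L^0(X)$ if, for some null set $E$, $|u(x)-u(y)|\le d(x,y)^s(g_k(x)+g_k(y))$ for all $k\in\mathbb Z$ and $x,y\in X\setminus E$ with $2^{-k-1}\le d(x,y)<2^{-k}$. A measurable $g:X\to[0,\infty]$ is an $s$-gradient of $u$ if, for some null set $E$, $|u(x)-u(y)|\le d(x,y)^s(g(x)+g(y))$ for all $x,y\in X\setminus E$. The spaces $N^s_{p,q}(X)$, $M^s_{p,q}(X)$ and $M^{s,p}(X)$ consist of the $u\in L^0(X)$ for which, respectively, $$\|u\|_{L^p}+\inf_{(g_k)}\big\|\big(\|g_k\|_{L^p}\big)_k\big\|_{\ell^q},\qquad \|u\|_{L^p}+\inf_{(g_k)}\big\|\,\|(g_k)_k\|_{\ell^q}\big\|_{L^p},\qquad \|u\|_{L^p}+\inf_{g}\|g\|_{L^p}$$ is finite, the infima being over the fractional $s$-gradients $(g_k)$, respectively the $s$-gradients $g$, of $u$; this quantity is denoted $\|u\|_{\mathcal F}$. Let $\mathcal F\in\{N^s_{p,q}(X),M^s_{p,q}(X)\}$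 with $0<s<1$, $1<p,q<\infty$, or $\mathcal F=M^s_{p,\infty}(X)=M^{s,p}(X)$ with $0<s\le1$, $1<p<\infty$. For $E\subset X$ put $$C_{\mathcal F}(E)=\inf\{\|u\|_{\mathcal F}^p:u\in\mathcal F,\ u\ge1\text{ on a neighbourhood of }E\}.$$ A function $u:X\to[-\infty,\infty]$ is quasicontinuous if for every $\varepsilon>0$ there is $E\subset X$ with $C_{\mathcal F}(E)<\varepsilon$ such that the restriction of $u$ to $X\setminus E$ is continuous. Theorem. Let $\mathcal B$ be a Busemann–Feller basis on $X$ and let $\mathcal F$ be as above. Consider the following claims. (1) For each $0<\gamma<1$ and $u\in\mathcal F$, $C_{\mathcal F}(\{x\in X:\mathcal M^\gamma_{\mathcal B}u(x)>\lambda\})\to0$ as $\lambda\to\infty$. (2) For each $0<\gamma<1$, $\lambda>0$ and each sequence $(u_k)$ in $\mathcal F$ with $\|u_k\|_{\mathcal F}\to0$ as $k\to\infty$, $C_{\mathcal F}(\{x\in X:\mathcal M^\gamma_{\mathcal B}u_k(x)>\lambda\})\to0$ as $k\to\infty$. (3) For every quasicontinuous $u\in\mathcal F$ there is a set $E$ with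 $C_{\mathcal F}(E)=0$ such that $\lim_{\mathcal B\ni B\to x}m^\gamma_u(B)=u(x)$ for every $0<\gamma<1$ and $x\in X\setminus E$. Then $(1)\Rightarrow(2)\Rightarrow(3)$. -/

import Mathlib

open Set Filter Topology MeasureTheory
open scoped ENNReal

noncomputable section

namespace MedianDiff

/-- The class of metric measure spaces under consideration: every ball has positive and finite
measure. A Borel regular outer measure is represented by its restriction to the Borel sets (a Borel
measure); its measurable sets and functions are then the null-measurable sets and the a.e.
measurable functions. -/
def BallsPosFinite {X : Type*} [MetricSpace X] [MeasurableSpace X] (μ : Measure X) : Prop :=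
  ∀ (x : X) (r : ℝ), 0 < r → 0 < μ (Metric.ball x r) ∧ μ (Metric.ball x r) < ∞

/-- `L⁰(X)`: measurable extended real valued functions that are finite almost everywhere. -/
def MemL0 {X : Type*} [MeasurableSpace X] (μ : Measure X) (u : X → EReal) : Prop :=
  AEMeasurable u μ ∧ ∀ᵐ x ∂μ, (u x).abs < ∞

/-! ### Medians, differentiation bases, the median maximal function -/

/-- The `γ`-median `inf {a ∈ ℝ : μ {x ∈ A : f x > a} < γ μ(A)}` of `f` over `A`. -/
def median {X : Type*} [MeasurableSpace X] (μ : Measure X) (γ : ℝ) (f : X → EReal) (A : Set X) :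
    EReal :=
  sInf ((fun a : ℝ => (a : EReal)) ''
    {a : ℝ | μ {x | x ∈ A ∧ (a : EReal) < f x} < ENNReal.ofReal γ * μ A})

/-- `𝓑 x` is the family of bounded measurable sets attached to the point `x`; each family contains
sets of arbitrarily small diameter. -/
structure IsDifferentiationBasis {X : Type*} [MetricSpace X] [MeasurableSpace X] (μ : Measure X)
    (𝓑 : X → Set (Set X)) : Prop where
  isBounded : ∀ x, ∀ B ∈ 𝓑 x, Bornology.IsBounded B
  measurable : ∀ x, ∀ B ∈ 𝓑 x, NullMeasurableSet B μ
  mem : ∀ x, ∀ B ∈ 𝓑 x, x ∈ B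
  exists_small : ∀ x, ∀ ε : ℝ, 0 < ε → ∃ B ∈ 𝓑 x, Metric.diam B < ε

/-- Busemann–Feller basis: all sets of the basis are open, and each of them belongs to the family of
every point that it contains. -/
structure IsBusemannFeller {X : Type*} [MetricSpace X] [MeasurableSpace X] (μ : Measure X)
    (𝓑 : X → Set (Set X)) : Prop extends IsDifferentiationBasis μ 𝓑 where
  isOpen : ∀ y, ∀ B ∈ 𝓑 y, IsOpen B
  mem_of_mem : ∀ y, ∀ B ∈ 𝓑 y, ∀ x ∈ B, B ∈ 𝓑 x

/-- `limsup` of a set function along the sets of the basis contracting to `x`; the supremum is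
monotone in `ε`, so its limit as `ε → 0` is the infimum. -/
def basisLimsup {X : Type*} [MetricSpace X] (𝓑 : X → Set (Set X)) (φ : Set X → EReal) (x : X) :
    EReal :=
  ⨅ (ε : ℝ) (_ : 0 < ε), sSup (φ '' {B | B ∈ 𝓑 x ∧ Metric.diam B < ε})

/-- `liminf` of a set function along the sets of the basis contracting to `x`. -/
def basisLiminf {X : Type*} [MetricSpace X] (𝓑 : X → Set (Set X)) (φ : Set X → EReal) (x : X) :
    EReal :=
  ⨆ (ε : ℝ) (_ : 0 < ε), sInf (φ '' {B | B ∈ 𝓑 x ∧ Metric.diam B < ε})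

/-- The set function `φ` has limit `l` along the sets of the basis contracting to `x`. -/
def HasBasisLim {X : Type*} [MetricSpace X] (𝓑 : X → Set (Set X)) (φ : Set X → EReal) (x : X)
    (l : EReal) : Prop :=
  basisLimsup 𝓑 φ x = l ∧ basisLiminf 𝓑 φ x = l

/-- The median maximal function `sup m^γ_{|u|}(B)` over all sets `B` of the basis that contain `x`. -/
def medianMaximal {X : Type*} [MeasurableSpace X] (μ : Measure X) (𝓑 : X → Set (Set X))
    (γ : ℝ) (u : X → EReal) (x : X) : EReal :=
  ⨆ (B : Set X) (_ : x ∈ B ∧ ∃ y, B ∈ 𝓑 y), median μ γ (fun y => ((u y).abs : EReal)) B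

/-! ### Gradients and norms -/

/-- `g` is an `s`-gradient of `u`. -/
def IsGradient {X : Type*} [MetricSpace X] [MeasurableSpace X] (μ : Measure X) (s : ℝ)
    (u : X → EReal) (g : X → ℝ≥0∞) : Prop :=
  AEMeasurable g μ ∧ ∃ E : Set X, μ E = 0 ∧ ∀ x ∉ E, ∀ y ∉ E,
    (u x - u y).abs ≤ edist x y ^ s * (g x + g y)

/-- `g` is a fractional `s`-gradient of `u`. -/
def IsFracGradient {X : Type*} [MetricSpace X] [MeasurableSpace X] (μ : Measure X) (s : ℝ)
    (u : X → EReal) (g : ℤ → X → ℝ≥0∞) : Prop :=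
  (∀ k, AEMeasurable (g k) μ) ∧ ∃ E : Set X, μ E = 0 ∧ ∀ k : ℤ, ∀ x ∉ E, ∀ y ∉ E,
    (2 : ℝ) ^ (-k - 1) ≤ dist x y → dist x y < (2 : ℝ) ^ (-k) →
      (u x - u y).abs ≤ edist x y ^ s * (g k x + g k y)

/-- The `ℓ^q`-norm of a sequence indexed by `ℤ`, `0 < q ≤ ∞`. -/
def lqNorm (q : ℝ≥0∞) (a : ℤ → ℝ≥0∞) : ℝ≥0∞ :=
  if q = ∞ then ⨆ k, a k else (∑' k, a k ^ q.toReal) ^ (1 / q.toReal)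

/-- Names of the function spaces: `besov s p q` is `N^s_{p,q}`, `triebelLizorkin s p q` is
`M^s_{p,q}`, and `hajlasz s p` is `M^{s,p}`. -/
inductive HajlaszSpace : Type
  | besov (s : ℝ) (p q : ℝ≥0∞)
  | triebelLizorkin (s : ℝ) (p q : ℝ≥0∞)
  | hajlasz (s : ℝ) (p : ℝ≥0∞)

namespace HajlaszSpace

/-- The integrability exponent `p` of the space. -/
def exponent : HajlaszSpace → ℝ≥0∞
  | besov _ p _ => p
  | triebelLizorkin _ p _ => p
  | hajlasz _ p => p

/-- The homogeneous seminorm (equal to `∞` if there is no gradient of finite norm). -/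
def seminorm {X : Type*} [MetricSpace X] [MeasurableSpace X] (μ : Measure X) :
    HajlaszSpace → (X → EReal) → ℝ≥0∞
  | besov s p q, u =>
      ⨅ (g : ℤ → X → ℝ≥0∞) (_ : IsFracGradient μ s u g), lqNorm q (fun k => eLpNorm (g k) p μ)
  | triebelLizorkin s p q, u =>
      ⨅ (g : ℤ → X → ℝ≥0∞) (_ : IsFracGradient μ s u g),
        eLpNorm (fun x => lqNorm q (fun k => g k x)) p μ
  | hajlasz s p, u => ⨅ (g : X → ℝ≥0∞) (_ : IsGradient μ s u g), eLpNorm g p μ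

/-- The inhomogeneous norm `‖u‖_{L^p} + ‖u‖` (with the homogeneous seminorm as second term). -/
def norm {X : Type*} [MetricSpace X] [MeasurableSpace X] (μ : Measure X) (F : HajlaszSpace)
    (u : X → EReal) : ℝ≥0∞ :=
  eLpNorm (fun x => (u x).abs) F.exponent μ + F.seminorm μ u

/-- Membership in the function space. -/
def Mem {X : Type*} [MetricSpace X] [MeasurableSpace X] (μ : Measure X) (F : HajlaszSpace)
    (u : X → EReal) : Prop :=
  MemL0 μ u ∧ F.norm μ u < ∞

/-- Functions in the space that are at least `1` on a neighbourhood of `E`. -/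
def admissible {X : Type*} [MetricSpace X] [MeasurableSpace X] (μ : Measure X) (F : HajlaszSpace)
    (E : Set X) : Set (X → EReal) :=
  {u | F.Mem μ u ∧ ∃ U : Set X, IsOpen U ∧ E ⊆ U ∧ ∀ x ∈ U, 1 ≤ u x}

/-- The capacity of a set: the infimum of `‖u‖^p` over the admissible functions. -/
def capacity {X : Type*} [MetricSpace X] [MeasurableSpace X] (μ : Measure X) (F : HajlaszSpace)
    (E : Set X) : ℝ≥0∞ :=
  ⨅ u ∈ F.admissible μ E, F.norm μ u ^ F.exponent.toReal

/-- `u` is quasicontinuous: its restriction to the complement of a set of arbitrarily small capacity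
is continuous. -/
def Quasicontinuous {X : Type*} [MetricSpace X] [MeasurableSpace X] (μ : Measure X)
    (F : HajlaszSpace) (u : X → EReal) : Prop :=
  ∀ ε : ℝ≥0∞, 0 < ε → ∃ E : Set X, F.capacity μ E < ε ∧ ContinuousOn u Eᶜ

/-- For all `γ` and all `u` in the space, the capacity of `{M^γ u > t}` tends to `0` as `t → ∞`. -/
def CapacityDecay {X : Type*} [MetricSpace X] [MeasurableSpace X] (μ : Measure X)
    (𝓑 : X → Set (Set X)) (F : HajlaszSpace) : Prop :=
  ∀ γ : ℝ, 0 < γ → γ < 1 → ∀ u : X → EReal, F.Mem μ u →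
    Tendsto (fun t : ℝ => F.capacity μ {x | (t : EReal) < medianMaximal μ 𝓑 γ u x}) atTop (𝓝 0)

/-- For all `γ`, all `t > 0` and all sequences converging to `0` in norm, the capacity of
`{M^γ u_k > t}` tends to `0` as `k → ∞`. -/
def CapacityContinuity {X : Type*} [MetricSpace X] [MeasurableSpace X] (μ : Measure X)
    (𝓑 : X → Set (Set X)) (F : HajlaszSpace) : Prop :=
  ∀ γ : ℝ, 0 < γ → γ < 1 → ∀ t : ℝ, 0 < t → ∀ u : ℕ → X → EReal, (∀ k, F.Mem μ (u k)) →
    Tendsto (fun k => F.norm μ (u k)) atTop (𝓝 0) →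
    Tendsto (fun k => F.capacity μ {x | (t : EReal) < medianMaximal μ 𝓑 γ (u k) x}) atTop (𝓝 0)

/-- The medians of a quasicontinuous function in the space converge to its values outside a set of
capacity zero that does not depend on `γ`. -/
def MedianDifferentiation {X : Type*} [MetricSpace X] [MeasurableSpace X] (μ : Measure X)
    (𝓑 : X → Set (Set X)) (F : HajlaszSpace) : Prop :=
  ∀ u : X → EReal, F.Mem μ u → F.Quasicontinuous μ u →
    ∃ E : Set X, F.capacity μ E = 0 ∧
      ∀ γ : ℝ, 0 < γ → γ < 1 → ∀ x ∉ E, HasBasisLim 𝓑 (median μ γ u) x (u x)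

end HajlaszSpace

end MedianDiff

end

/-! Everything rests on two facts: absolutely convergent series of absolute values stay in the
space, and the median maximal function is monotone and positively homogeneous.

(1) ⇒ (2). If (2) fails for some `t`, infinitely many of the sets `{M u_k > t}` have capacity above
a fixed `ε`. Select such indices `k_n` with `∑ (n+1) ‖u_{k_n}‖ < ∞`. By Minkowski for series
(`Mem.tsum`), `w = ∑ (n+1) |u_{k_n}|` lies in the space, and `(n+1) |u_{k_n}| ≤ w` gives `{M u_{k_n}
> t} ⊆ {M w > (n+1) t}`. The capacity of the latter tends to zero by (1), a contradiction.

(2) ⇒ (3). Quasicontinuity yields sets `E_k` inside open `U_k`, with `u` continuous off `E_k`, and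
functions `v_k ≥ 1` on `U_k` with norms tending to zero. By (2) the set where `M^θ v_k > 1/2` for
every `k` has capacity zero. At any other point some `k` satisfies `M^θ v_k(x) ≤ 1/2`; then `x ∉
E_k`, and `U_k` fills less than a fraction `θ` of each basis set at `x`. With `θ ≤ min(γ, 1-γ)` this
is too little to move the `γ`-median away from the values of `u` off `U_k`, which are close to `u x`
(`hasBasisLim_median`). Countably many `θ` suffice, by countable subadditivity of `capacity ^
(1/p)`. -/

namespace MedianDiff

/-! ### Absolute values of extended reals -/

theorem abs_coe_ennreal (a : ℝ≥0∞) : (a : EReal).abs = a := by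
  induction a with
  | top => simp
  | coe r =>
    have : (((r : ℝ≥0∞)) : EReal) = ((r : ℝ) : EReal) := rfl
    rw [this, EReal.abs_def, abs_of_nonneg r.coe_nonneg, ENNReal.ofReal_coe_nnreal]

theorem measurable_ereal_abs : Measurable EReal.abs := by
  refine EReal.measurable_of_measurable_real ?_
  simp only [EReal.abs_def]
  fun_prop

theorem abs_le_abs_add_abs_sub (u v : EReal) : u.abs ≤ v.abs + (u - v).abs := by
  induction v with
  | bot => simp
  | top => simp
  | coe b =>
    induction u with
    | bot => simp
    | top => simp
    | coe a =>
      rw [← EReal.coe_sub, EReal.abs_def, EReal.abs_def, EReal.abs_def,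
        ← ENNReal.ofReal_add (abs_nonneg _) (abs_nonneg _)]
      refine ENNReal.ofReal_le_ofReal ?_
      have := abs_add_le b (a - b)
      simpa using this

theorem one_le_abs {u : EReal} (h : 1 ≤ u) : 1 ≤ u.abs := by
  induction u with
  | bot => simp
  | top => simp
  | coe a =>
    have : (1 : ℝ) ≤ a := by exact_mod_cast h
    rw [EReal.abs_def]
    simpa using this.trans (le_abs_self a)

theorem abs_sub_comm_ereal (u v : EReal) (hu : u.abs ≠ ∞) (hv : v.abs ≠ ∞) :
    (u - v).abs = (v - u).abs := by
  induction u with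
  | bot => simp at hu
  | top => simp at hu
  | coe a =>
    induction v with
    | bot => simp at hv
    | top => simp at hv
    | coe b =>
      rw [← EReal.coe_sub, ← EReal.coe_sub, EReal.abs_def, EReal.abs_def, abs_sub_comm]

/-- Finiteness matters: `⊤ - ⊤ = ⊥` in `EReal`, which has absolute value `∞`. -/
theorem abs_coe_sub_coe_le {a b d : ℝ≥0∞} (ha : a ≠ ∞) (hb : b ≠ ∞) (hab : a ≤ b + d)
    (hba : b ≤ a + d) : ((a : EReal) - (b : EReal)).abs ≤ d := by
  lift a to NNReal using ha
  lift b to NNReal using hb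
  induction d with
  | top => exact le_top
  | coe d =>
    norm_cast at hab hba
    have h1 : (((a : ℝ≥0∞)) : EReal) = ((a : ℝ) : EReal) := rfl
    have h2 : (((b : ℝ≥0∞)) : EReal) = ((b : ℝ) : EReal) := rfl
    rw [h1, h2, ← EReal.coe_sub, EReal.abs_def, ← ENNReal.ofReal_coe_nnreal (p := d)]
    refine ENNReal.ofReal_le_ofReal (abs_le.2 ⟨?_, ?_⟩)
    · have : (b : ℝ) ≤ a + d := by exact_mod_cast hba
      linarith
    · have : (a : ℝ) ≤ b + d := by exact_mod_cast hab
      linarith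

theorem abs_tsum_sub_tsum_le (c : ℕ → NNReal) (a b : ℕ → EReal)
    (ha : ∑' n, c n * (a n).abs ≠ ∞) (hb : ∑' n, c n * (b n).abs ≠ ∞)
    (hfa : ∀ n, (a n).abs ≠ ∞) (hfb : ∀ n, (b n).abs ≠ ∞) :
    (((∑' n, c n * (a n).abs : ℝ≥0∞) : EReal) - ((∑' n, c n * (b n).abs : ℝ≥0∞) : EReal)).abs
      ≤ ∑' n, c n * (a n - b n).abs := by
  refine abs_coe_sub_coe_le ha hb ?_ ?_
  · rw [← ENNReal.tsum_add]
    refine ENNReal.tsum_le_tsum fun n => ?_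
    rw [← mul_add]
    gcongr
    exact abs_le_abs_add_abs_sub _ _
  · rw [← ENNReal.tsum_add]
    refine ENNReal.tsum_le_tsum fun n => ?_
    rw [← mul_add, abs_sub_comm_ereal _ _ (hfa n) (hfb n)]
    gcongr
    exact abs_le_abs_add_abs_sub _ _

/-! ### Minkowski's inequality for series -/

theorem iSup_rpow_ennreal {ι : Type*} {r : ℝ} (hr : 0 < r) (f : ι → ℝ≥0∞) :
    (⨆ i, f i) ^ r = ⨆ i, f i ^ r :=
  (ENNReal.orderIsoRpow r hr).map_iSup f

theorem eLpNorm_const_mul_ennreal {α : Type*} [MeasurableSpace α] {μ : Measure α} {p : ℝ≥0∞}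
    (hp : 1 ≤ p) (hp' : p ≠ ∞) (c : NNReal) (f : α → ℝ≥0∞) :
    eLpNorm (fun x => c * f x) p μ = c * eLpNorm f p μ := by
  have hp0 : p ≠ 0 := (zero_lt_one.trans_le hp).ne'
  have hr : 0 < p.toReal := ENNReal.toReal_pos hp0 hp'
  rw [eLpNorm_eq_lintegral_rpow_enorm_toReal hp0 hp', eLpNorm_eq_lintegral_rpow_enorm_toReal hp0 hp']
  simp only [enorm_eq_self, ENNReal.mul_rpow_of_nonneg _ _ hr.le]
  rw [lintegral_const_mul' _ _ (ENNReal.rpow_ne_top_of_nonneg hr.le ENNReal.coe_ne_top),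
    ENNReal.mul_rpow_of_nonneg _ _ (by positivity), ← ENNReal.rpow_mul,
    mul_one_div_cancel hr.ne', ENNReal.rpow_one]

/-- Minkowski for partial sums passes to the limit by monotone convergence. -/
theorem eLpNorm_tsum_le {α : Type*} [MeasurableSpace α] {μ : Measure α} {p : ℝ≥0∞}
    (hp : 1 ≤ p) (hp' : p ≠ ∞) {f : ℕ → α → ℝ≥0∞} (hf : ∀ n, AEMeasurable (f n) μ) :
    eLpNorm (fun x => ∑' n, f n x) p μ ≤ ∑' n, eLpNorm (f n) p μ := by
  have hp0 : p ≠ 0 := (zero_lt_one.trans_le hp).ne'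
  have hr : 0 < p.toReal := ENNReal.toReal_pos hp0 hp'
  rw [eLpNorm_eq_lintegral_rpow_enorm_toReal hp0 hp']
  simp only [enorm_eq_self, ENNReal.tsum_eq_iSup_nat, iSup_rpow_ennreal hr]
  rw [lintegral_iSup', iSup_rpow_ennreal (by positivity)]
  · refine iSup_mono fun N => ?_
    have := eLpNorm_sum_le (μ := μ) (p := p) (f := f) (s := Finset.range N)
      (fun i _ => (hf i).aestronglyMeasurable) hp
    rw [eLpNorm_eq_lintegral_rpow_enorm_toReal hp0 hp'] at this
    simpa only [enorm_eq_self, Finset.sum_apply] using this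
  · intro N
    exact (Finset.aemeasurable_fun_sum _ fun i _ => hf i).pow_const _
  · refine Eventually.of_forall fun x M N hMN => ?_
    exact ENNReal.rpow_le_rpow
      (Finset.sum_le_sum_of_subset (Finset.range_mono hMN)) hr.le

theorem eLpNorm_tsum_const_mul_le {α : Type*} [MeasurableSpace α] {μ : Measure α} {p : ℝ≥0∞}
    (hp : 1 ≤ p) (hp' : p ≠ ∞) (c : ℕ → NNReal) {f : ℕ → α → ℝ≥0∞}
    (hf : ∀ n, AEMeasurable (f n) μ) :
    eLpNorm (fun x => ∑' n, c n * f n x) p μ ≤ ∑' n, c n * eLpNorm (f n) p μ := by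
  refine (eLpNorm_tsum_le hp hp' fun n => (hf n).const_mul _).trans_eq ?_
  simp only [eLpNorm_const_mul_ennreal hp hp']

/-- Lets the same series Minkowski inequality serve for both the `L^p` and the `ℓ^q` layer of the
norms. -/
theorem lqNorm_eq_eLpNorm {q : ℝ≥0∞} (hq : 1 ≤ q) (hq' : q ≠ ∞) (a : ℤ → ℝ≥0∞) :
    lqNorm q a = eLpNorm a q Measure.count := by
  rw [eLpNorm_eq_lintegral_rpow_enorm_toReal (zero_lt_one.trans_le hq).ne' hq', lqNorm,
    if_neg hq', lintegral_count]
  simp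

theorem lqNorm_tsum_const_mul_le {q : ℝ≥0∞} (hq : 1 ≤ q) (c : ℕ → NNReal) (a : ℕ → ℤ → ℝ≥0∞) :
    lqNorm q (fun k => ∑' n, c n * a n k) ≤ ∑' n, c n * lqNorm q (a n) := by
  by_cases hq' : q = ∞
  · simp only [lqNorm, if_pos hq']
    refine iSup_le fun k => ENNReal.tsum_le_tsum fun n => ?_
    gcongr
    exact le_iSup (a n) k
  · simp only [lqNorm_eq_eLpNorm hq hq']
    exact eLpNorm_tsum_const_mul_le hq hq' c fun n => (measurable_of_countable _).aemeasurable

theorem lqNorm_mono {q : ℝ≥0∞} {a b : ℤ → ℝ≥0∞} (h : ∀ k, a k ≤ b k) : lqNorm q a ≤ lqNorm q b := by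
  unfold lqNorm
  split_ifs
  · exact iSup_mono h
  · gcongr with k
    exact h k

theorem aemeasurable_lqNorm {α : Type*} [MeasurableSpace α] {μ : Measure α} (q : ℝ≥0∞)
    {g : ℤ → α → ℝ≥0∞} (hg : ∀ k, AEMeasurable (g k) μ) :
    AEMeasurable (fun x => lqNorm q fun k => g k x) μ := by
  unfold lqNorm
  split_ifs
  · exact AEMeasurable.iSup hg
  · exact (AEMeasurable.tsum fun k => (hg k).pow_const _).pow_const _

/-! ### Norms of series in the function spaces -/

/-- Increments are estimated termwise. The exceptional set also absorbs the points where some `u n`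
or the whole series is infinite. -/
theorem IsGradient.tsum {X : Type*} [MetricSpace X] [MeasurableSpace X] {μ : Measure X} {s : ℝ}
    {u : ℕ → X → EReal} {g : ℕ → X → ℝ≥0∞} (h : ∀ n, IsGradient μ s (u n) (g n)) (c : ℕ → NNReal)
    (hu : ∀ n, ∀ᵐ x ∂μ, (u n x).abs < ∞) (hW : ∀ᵐ x ∂μ, ∑' n, c n * (u n x).abs ≠ ∞) :
    IsGradient μ s (fun x => ((∑' n, c n * (u n x).abs : ℝ≥0∞) : EReal))
      (fun x => ∑' n, c n * g n x) := by
  choose hm E hE h using h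
  refine ⟨AEMeasurable.tsum fun n => (hm n).const_mul _,
    (⋃ n, E n) ∪ {x | ¬ ((∀ n, (u n x).abs < ∞) ∧ ∑' n, c n * (u n x).abs ≠ ∞)},
    measure_union_null (measure_iUnion_null hE) ((ae_all_iff.2 hu).and hW), ?_⟩
  intro x hx y hy
  simp only [mem_union, mem_iUnion, mem_ofPred_eq, not_or, not_exists, not_not] at hx hy
  refine (abs_tsum_sub_tsum_le c _ _ hx.2.2 hy.2.2 (fun n => (hx.2.1 n).ne)
    fun n => (hy.2.1 n).ne).trans ?_
  rw [← ENNReal.tsum_add, ← ENNReal.tsum_mul_left]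
  refine ENNReal.tsum_le_tsum fun n => ?_
  rw [← mul_add, mul_left_comm]
  gcongr
  exact h n x (hx.1 n) y (hy.1 n)

theorem IsFracGradient.tsum {X : Type*} [MetricSpace X] [MeasurableSpace X] {μ : Measure X} {s : ℝ}
    {u : ℕ → X → EReal} {g : ℕ → ℤ → X → ℝ≥0∞} (h : ∀ n, IsFracGradient μ s (u n) (g n))
    (c : ℕ → NNReal) (hu : ∀ n, ∀ᵐ x ∂μ, (u n x).abs < ∞)
    (hW : ∀ᵐ x ∂μ, ∑' n, c n * (u n x).abs ≠ ∞) :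
    IsFracGradient μ s (fun x => ((∑' n, c n * (u n x).abs : ℝ≥0∞) : EReal))
      (fun k x => ∑' n, c n * g n k x) := by
  choose hm E hE h using h
  refine ⟨fun k => AEMeasurable.tsum fun n => (hm n k).const_mul _,
    (⋃ n, E n) ∪ {x | ¬ ((∀ n, (u n x).abs < ∞) ∧ ∑' n, c n * (u n x).abs ≠ ∞)},
    measure_union_null (measure_iUnion_null hE) ((ae_all_iff.2 hu).and hW), ?_⟩
  intro k x hx y hy hxy hxy'
  simp only [mem_union, mem_iUnion, mem_ofPred_eq, not_or, not_exists, not_not] at hx hy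
  refine (abs_tsum_sub_tsum_le c _ _ hx.2.2 hy.2.2 (fun n => (hx.2.1 n).ne)
    fun n => (hy.2.1 n).ne).trans ?_
  rw [← ENNReal.tsum_add, ← ENNReal.tsum_mul_left]
  refine ENNReal.tsum_le_tsum fun n => ?_
  rw [← mul_add, mul_left_comm]
  gcongr
  exact h n k x (hx.1 n) y (hy.1 n) hxy hxy'

/-- An infimum of costs is countably subadditive if candidates can be combined so that the cost of
the combination is at most the weighted sum of the costs. -/
theorem iInf_le_tsum_const_mul_iInf {G : Type*} {P : ℕ → G → Prop} {Q : G → Prop} {N : G → ℝ≥0∞}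
    (c : ℕ → NNReal) (hfin : ∀ n, ⨅ (g : G) (_ : P n g), N g ≠ ∞)
    (h : ∀ g : ℕ → G, (∀ n, P n (g n)) → ∃ g', Q g' ∧ N g' ≤ ∑' n, c n * N (g n)) :
    ⨅ (g : G) (_ : Q g), N g ≤ ∑' n, c n * ⨅ (g : G) (_ : P n g), N g := by
  refine ENNReal.le_of_forall_pos_le_add fun ε hε _ => ?_
  -- The weights may be unbounded, so the errors of the near-minimisers are chosen with `∑ c n * δ n
  -- < ε`.
  obtain ⟨δ, hδ, hsum⟩ := ENNReal.exists_pos_tsum_mul_lt_of_countable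
    (ENNReal.coe_pos.2 hε).ne' (fun n => (c n : ℝ≥0∞)) fun n => ENNReal.coe_ne_top
  have hex : ∀ n, ∃ g, P n g ∧ N g < (⨅ (g : G) (_ : P n g), N g) + δ n := by
    intro n
    have := ENNReal.lt_add_right (hfin n) (ENNReal.coe_pos.2 (hδ n)).ne'
    simpa only [iInf_lt_iff, exists_prop] using this
  choose g hg hgN using hex
  obtain ⟨g', hg', hN⟩ := h g hg
  calc ⨅ (g : G) (_ : Q g), N g ≤ N g' := iInf₂_le g' hg'
    _ ≤ ∑' n, c n * N (g n) := hN
    _ ≤ ∑' n, (c n * (⨅ (g : G) (_ : P n g), N g) + c n * δ n) :=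
        ENNReal.tsum_le_tsum fun n => by
          rw [← mul_add]
          gcongr
          exact (hgN n).le
    _ ≤ _ := by
        rw [ENNReal.tsum_add]
        gcongr

namespace HajlaszSpace

/-- The exponents are in the range where the triangle inequality holds. -/
def IsBanachRange : HajlaszSpace → Prop
  | besov _ p q => 1 ≤ p ∧ p ≠ ∞ ∧ 1 ≤ q
  | triebelLizorkin _ p q => 1 ≤ p ∧ p ≠ ∞ ∧ 1 ≤ q
  | hajlasz _ p => 1 ≤ p ∧ p ≠ ∞

theorem IsBanachRange.one_le_exponent {F : HajlaszSpace} (hF : F.IsBanachRange) :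
    1 ≤ F.exponent := by
  cases F <;> exact hF.1

theorem IsBanachRange.exponent_ne_top {F : HajlaszSpace} (hF : F.IsBanachRange) :
    F.exponent ≠ ∞ := by
  cases F
  · exact hF.2.1
  · exact hF.2.1
  · exact hF.2

theorem IsBanachRange.toReal_exponent_pos {F : HajlaszSpace} (hF : F.IsBanachRange) :
    0 < F.exponent.toReal :=
  ENNReal.toReal_pos (zero_lt_one.trans_le hF.one_le_exponent).ne' hF.exponent_ne_top

variable {X : Type*} [MetricSpace X] [MeasurableSpace X] {μ : Measure X} {F : HajlaszSpace}

/-- Summing near-optimal gradients reduces the claim to Minkowski, applied to the inner norm and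
then the outer one; the two mixed norms differ only in that order. -/
theorem seminorm_tsum_le (hF : F.IsBanachRange) (c : ℕ → NNReal) {u : ℕ → X → EReal}
    (hu : ∀ n, ∀ᵐ x ∂μ, (u n x).abs < ∞) (hW : ∀ᵐ x ∂μ, ∑' n, c n * (u n x).abs ≠ ∞)
    (hfin : ∀ n, F.seminorm μ (u n) ≠ ∞) :
    F.seminorm μ (fun x => ((∑' n, c n * (u n x).abs : ℝ≥0∞) : EReal))
      ≤ ∑' n, c n * F.seminorm μ (u n) := by
  cases F with
  | besov s p q =>
    obtain ⟨hp, hp', hq⟩ := hF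
    refine iInf_le_tsum_const_mul_iInf c hfin fun g hg => ⟨_, IsFracGradient.tsum hg c hu hW, ?_⟩
    refine le_trans (lqNorm_mono fun k => ?_) (lqNorm_tsum_const_mul_le hq c _)
    exact eLpNorm_tsum_const_mul_le hp hp' c fun n => (hg n).1 k
  | triebelLizorkin s p q =>
    obtain ⟨hp, hp', hq⟩ := hF
    refine iInf_le_tsum_const_mul_iInf c hfin fun g hg => ⟨_, IsFracGradient.tsum hg c hu hW, ?_⟩
    refine le_trans (eLpNorm_mono_enorm fun x => ?_) (eLpNorm_tsum_const_mul_le hp hp' c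
      fun n => aemeasurable_lqNorm q (hg n).1)
    simpa only [enorm_eq_self] using lqNorm_tsum_const_mul_le hq c fun n k => g n k x
  | hajlasz s p =>
    obtain ⟨hp, hp'⟩ := hF
    refine iInf_le_tsum_const_mul_iInf c hfin fun g hg => ⟨_, IsGradient.tsum hg c hu hW, ?_⟩
    exact eLpNorm_tsum_const_mul_le hp hp' c fun n => (hg n).1

theorem Mem.tsum (hF : F.IsBanachRange) (c : ℕ → NNReal) {u : ℕ → X → EReal}
    (hu : ∀ n, F.Mem μ (u n)) (hsum : ∑' n, c n * F.norm μ (u n) ≠ ∞) :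
    F.Mem μ (fun x => ((∑' n, c n * (u n x).abs : ℝ≥0∞) : EReal)) ∧
      F.norm μ (fun x => ((∑' n, c n * (u n x).abs : ℝ≥0∞) : EReal))
        ≤ ∑' n, c n * F.norm μ (u n) := by
  have hp := hF.one_le_exponent
  have hp' := hF.exponent_ne_top
  have hr := hF.toReal_exponent_pos
  have hm : ∀ n, AEMeasurable (fun x => (u n x).abs) μ := fun n =>
    measurable_ereal_abs.comp_aemeasurable (hu n).1.1
  have hWm : AEMeasurable (fun x => ∑' n, c n * (u n x).abs) μ :=
    AEMeasurable.tsum fun n => (hm n).const_mul _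
  have hLp := eLpNorm_tsum_const_mul_le hp hp' c hm
  have hsplit : ∑' n, c n * F.norm μ (u n) =
      ∑' n, c n * eLpNorm (fun x => (u n x).abs) F.exponent μ
        + ∑' n, c n * F.seminorm μ (u n) := by
    rw [← ENNReal.tsum_add]
    exact tsum_congr fun n => mul_add _ _ _
  -- The series has finite `L^p` norm, so its `p`-th power is integrable and hence finite a.e.
  have hWfin : ∀ᵐ x ∂μ, ∑' n, c n * (u n x).abs ≠ ∞ := by
    have h1 : eLpNorm (fun x => ∑' n, c n * (u n x).abs) F.exponent μ < ∞ :=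
      (hLp.trans (hsplit ▸ le_self_add)).trans_lt hsum.lt_top
    have h2 := lintegral_rpow_enorm_lt_top_of_eLpNorm_lt_top
      (zero_lt_one.trans_le hp).ne' hp' h1
    simp only [enorm_eq_self] at h2
    filter_upwards [ae_lt_top' (hWm.pow_const _) h2.ne] with x hx htop
    simp [htop, hr] at hx
  have hsemi := seminorm_tsum_le hF c (fun n => (hu n).1.2) hWfin fun n =>
    (le_add_self.trans_lt (hu n).2).ne
  have hnorm : F.norm μ (fun x => ((∑' n, c n * (u n x).abs : ℝ≥0∞) : EReal))
        ≤ ∑' n, c n * F.norm μ (u n) := by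
    rw [hsplit]
    unfold norm
    simp only [abs_coe_ennreal]
    exact add_le_add hLp hsemi
  refine ⟨⟨⟨hWm.coe_ereal_ennreal, ?_⟩, hnorm.trans_lt hsum.lt_top⟩, hnorm⟩
  simpa only [abs_coe_ennreal, lt_top_iff_ne_top] using hWfin

/-! ### Capacity -/

theorem capacity_mono {A B : Set X} (h : A ⊆ B) : F.capacity μ A ≤ F.capacity μ B :=
  biInf_mono fun _ hu => ⟨hu.1, hu.2.imp fun _ hU => ⟨hU.1, h.trans hU.2.1, hU.2.2⟩⟩

/-- The `1/p`-th power turns capacity into an infimum of norms, and the sum of the `|v n|` for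
near-minimisers `v n` is at least `1` on the union of their neighbourhoods. -/
theorem capacity_iUnion_rpow_le (hF : F.IsBanachRange) (A : ℕ → Set X) :
    F.capacity μ (⋃ n, A n) ^ (1 / F.exponent.toReal)
      ≤ ∑' n, F.capacity μ (A n) ^ (1 / F.exponent.toReal) := by
  have hr := hF.toReal_exponent_pos
  set p := F.exponent.toReal
  refine ENNReal.le_of_forall_pos_le_add fun ε hε hfin => ?_
  obtain ⟨δ, hδ, hsum⟩ := ENNReal.exists_pos_sum_of_countable (ENNReal.coe_pos.2 hε).ne' ℕ
  have hex : ∀ n, ∃ v ∈ F.admissible μ (A n),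
      F.norm μ v < F.capacity μ (A n) ^ (1 / p) + δ n := by
    intro n
    have h1 : F.capacity μ (A n) ^ (1 / p) < F.capacity μ (A n) ^ (1 / p) + δ n :=
      ENNReal.lt_add_right (ENNReal.ne_top_of_tsum_ne_top hfin.ne n) (ENNReal.coe_pos.2 (hδ n)).ne'
    rw [one_div, ENNReal.rpow_inv_lt_iff hr] at h1
    obtain ⟨v, hv, hlt⟩ : ∃ v ∈ F.admissible μ (A n), F.norm μ v ^ p <
        (F.capacity μ (A n) ^ p⁻¹ + δ n) ^ p := by
      simpa only [capacity, iInf_lt_iff, exists_prop] using h1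
    refine ⟨v, hv, ?_⟩
    rw [one_div]
    exact (ENNReal.rpow_lt_rpow_iff hr).1 hlt
  choose v hv hvlt using hex
  have hle : ∑' n, F.norm μ (v n) ≤ ∑' n, F.capacity μ (A n) ^ (1 / p) + ε := by
    refine (ENNReal.tsum_le_tsum fun n => (hvlt n).le).trans ?_
    rw [ENNReal.tsum_add]
    gcongr
  obtain ⟨hmem, hnorm⟩ := Mem.tsum hF (fun _ => 1) (fun n => (hv n).1) (by
    simpa only [ENNReal.coe_one, one_mul] using
      (hle.trans_lt (ENNReal.add_lt_top.2 ⟨hfin, ENNReal.coe_lt_top⟩)).ne)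
  choose U hU hAU hone using fun n => (hv n).2
  have hadm : (fun x => ((∑' n, ((1 : NNReal) : ℝ≥0∞) * (v n x).abs : ℝ≥0∞) : EReal)) ∈
      F.admissible μ (⋃ n, A n) := by
    refine ⟨hmem, ⋃ n, U n, isOpen_iUnion hU, iUnion_mono hAU, fun x hx => ?_⟩
    obtain ⟨n, hn⟩ := mem_iUnion.1 hx
    have h1 : (1 : ℝ≥0∞) ≤ (v n x).abs := one_le_abs (hone n x hn)
    have h2 : (1 : ℝ≥0∞) ≤ ∑' n, ((1 : NNReal) : ℝ≥0∞) * (v n x).abs := by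
      refine h1.trans ?_
      simpa only [ENNReal.coe_one, one_mul] using ENNReal.le_tsum (f := fun n => (v n x).abs) n
    exact EReal.coe_ennreal_one ▸ EReal.coe_ennreal_le_coe_ennreal_iff.2 h2
  calc F.capacity μ (⋃ n, A n) ^ (1 / p)
      ≤ F.norm μ (fun x => ((∑' n, ((1 : NNReal) : ℝ≥0∞) * (v n x).abs : ℝ≥0∞) : EReal)) := by
        rw [one_div, ENNReal.rpow_inv_le_iff hr]
        exact iInf₂_le _ hadm
    _ ≤ ∑' n, F.norm μ (v n) := by simpa only [ENNReal.coe_one, one_mul] using hnorm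
    _ ≤ _ := hle

theorem capacity_iUnion_eq_zero (hF : F.IsBanachRange) {A : ℕ → Set X}
    (hA : ∀ n, F.capacity μ (A n) = 0) : F.capacity μ (⋃ n, A n) = 0 := by
  have h := capacity_iUnion_rpow_le (μ := μ) hF A
  have hr := hF.toReal_exponent_pos
  simpa [hA, hr, hr.le, hr.not_gt] using h

end HajlaszSpace

/-! ### Medians -/

section Median

variable {X : Type*} [MeasurableSpace X] {μ : Measure X} {γ : ℝ}

theorem median_le_coe {f : X → EReal} {A : Set X} {b : ℝ}
    (h : μ {x | x ∈ A ∧ (b : EReal) < f x} < ENNReal.ofReal γ * μ A) : median μ γ f A ≤ b :=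
  sInf_le ⟨b, h, rfl⟩

theorem coe_le_median {f : X → EReal} {A : Set X} {a : ℝ}
    (h : ∀ b < a, ENNReal.ofReal γ * μ A ≤ μ {x | x ∈ A ∧ (b : EReal) < f x}) :
    a ≤ median μ γ f A := by
  refine le_sInf ?_
  rintro _ ⟨b, hb, rfl⟩
  refine EReal.coe_le_coe_iff.2 (le_of_not_gt fun hba => ?_)
  exact (h b hba).not_gt hb

theorem measure_lt_of_median_lt {f : X → EReal} {A : Set X} {a : ℝ}
    (h : median μ γ f A < a) :
    μ {x | x ∈ A ∧ (a : EReal) < f x} < ENNReal.ofReal γ * μ A := by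
  obtain ⟨_, ⟨b, hb, rfl⟩, hba⟩ := sInf_lt_iff.1 h
  refine (measure_mono fun x hx => ?_).trans_lt hb
  exact ⟨hx.1, hba.trans hx.2⟩

/-- Multiplying a function by at least `c` multiplies its medians by at least `c`. -/
theorem mul_lt_median_of_lt_median {f g : X → EReal} {A : Set X} {c t : ℝ} (hc : 0 < c)
    (hfg : ∀ (x : X) (b : ℝ), (b : EReal) < f x → ((c * b : ℝ) : EReal) < g x)
    (h : (t : EReal) < median μ γ f A) : ((c * t : ℝ) : EReal) < median μ γ g A := by
  -- The level-set comparison only gives `c * t' ≤ median`; the gap `t < t'` restores strictness.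
  obtain ⟨t', htt', ht'⟩ := EReal.lt_iff_exists_real_btwn.1 h
  have hlt : c * t < c * t' := mul_lt_mul_of_pos_left (EReal.coe_lt_coe_iff.1 htt') hc
  refine (EReal.coe_lt_coe_iff.2 hlt).trans_le (coe_le_median fun b hb => ?_)
  have hb' : b / c < t' := (div_lt_iff₀' hc).2 hb
  have hnot : ¬ μ {x | x ∈ A ∧ ((b / c : ℝ) : EReal) < f x} < ENNReal.ofReal γ * μ A := fun hlt =>
    ((EReal.coe_lt_coe_iff.2 hb').trans ht').not_ge (median_le_coe hlt)
  refine (not_lt.1 hnot).trans (measure_mono fun x hx => ⟨hx.1, ?_⟩)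
  have := hfg x _ hx.2
  rwa [mul_div_cancel₀ _ hc.ne'] at this

theorem median_le_medianMaximal {𝓑 : X → Set (Set X)} {u : X → EReal} {x : X} {B : Set X}
    (hx : x ∈ B) {y : X} (hB : B ∈ 𝓑 y) :
    median μ γ (fun z => ((u z).abs : EReal)) B ≤ medianMaximal μ 𝓑 γ u x :=
  le_iSup₂_of_le B ⟨hx, y, hB⟩ le_rfl

theorem mul_lt_medianMaximal {𝓑 : X → Set (Set X)} {u w : X → EReal} {x : X} {c : NNReal} {t : ℝ}
    (hc : 0 < c) (huw : ∀ z, c * (u z).abs ≤ (w z).abs)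
    (h : (t : EReal) < medianMaximal μ 𝓑 γ u x) :
    ((c * t : ℝ) : EReal) < medianMaximal μ 𝓑 γ w x := by
  simp only [medianMaximal, lt_iSup_iff] at h ⊢
  obtain ⟨B, hB, h⟩ := h
  refine ⟨B, hB, mul_lt_median_of_lt_median (c := c) hc (fun z b hb => ?_) h⟩
  have h1 : ((c * (u z).abs : ℝ≥0∞) : EReal) ≤ ((w z).abs : EReal) :=
    EReal.coe_ennreal_le_coe_ennreal_iff.2 (huw z)
  refine lt_of_lt_of_le ?_ h1
  generalize (u z).abs = a at hb
  induction a with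
  | top =>
    rw [ENNReal.mul_top (by simpa using hc.ne'), EReal.coe_ennreal_top]
    exact EReal.coe_lt_top _
  | coe a =>
    have e1 : (((a : ℝ≥0∞)) : EReal) = ((a : ℝ) : EReal) := rfl
    have e2 : ((c * a : ℝ≥0∞) : EReal) = ((c * a : ℝ) : EReal) := by
      rw [← ENNReal.coe_mul]
      rfl
    rw [e1, EReal.coe_lt_coe_iff] at hb
    rw [e2, EReal.coe_lt_coe_iff]
    exact mul_lt_mul_of_pos_left hb hc

end Median

/-! ### Limits along a basis -/

section BasisLimit

variable {X : Type*} [MetricSpace X] [MeasurableSpace X] {μ : Measure X} {𝓑 : X → Set (Set X)}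

theorem IsDifferentiationBasis.basisLiminf_le_basisLimsup (h𝓑 : IsDifferentiationBasis μ 𝓑)
    (φ : Set X → EReal) (x : X) : basisLiminf 𝓑 φ x ≤ basisLimsup 𝓑 φ x := by
  refine iSup₂_le fun ε hε => le_iInf₂ fun δ hδ => ?_
  obtain ⟨B, hB, hlt⟩ := h𝓑.exists_small x (min ε δ) (lt_min hε hδ)
  have h1 : B ∈ {B | B ∈ 𝓑 x ∧ Metric.diam B < ε} := ⟨hB, hlt.trans_le (min_le_left _ _)⟩
  have h2 : B ∈ {B | B ∈ 𝓑 x ∧ Metric.diam B < δ} := ⟨hB, hlt.trans_le (min_le_right _ _)⟩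
  exact (sInf_le (mem_image_of_mem φ h1)).trans (le_sSup (mem_image_of_mem φ h2))

/-- Arbitrarily small basis sets at `x` force liminf ≤ limsup, so one-sided bounds suffice; real
levels are enough by density, even for infinite `l`. -/
theorem IsDifferentiationBasis.hasBasisLim (h𝓑 : IsDifferentiationBasis μ 𝓑)
    {φ : Set X → EReal} {x : X} {l : EReal}
    (hup : ∀ b : ℝ, l < b → ∃ δ : ℝ, 0 < δ ∧ ∀ B ∈ 𝓑 x, Metric.diam B < δ → φ B ≤ b)
    (hlow : ∀ a : ℝ, a < l → ∃ δ : ℝ, 0 < δ ∧ ∀ B ∈ 𝓑 x, Metric.diam B < δ → a ≤ φ B) :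
    HasBasisLim 𝓑 φ x l := by
  have h1 : basisLimsup 𝓑 φ x ≤ l := by
    refine EReal.le_of_forall_lt_iff_le.1 fun b hb => ?_
    obtain ⟨δ, hδ, h⟩ := hup b hb
    refine iInf₂_le_of_le δ hδ (sSup_le ?_)
    rintro _ ⟨B, hB, rfl⟩
    exact h B hB.1 hB.2
  have h2 : l ≤ basisLiminf 𝓑 φ x := by
    refine EReal.ge_of_forall_gt_iff_ge.1 fun a ha => ?_
    obtain ⟨δ, hδ, h⟩ := hlow a ha
    refine le_iSup₂_of_le δ hδ (le_sInf ?_)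
    rintro _ ⟨B, hB, rfl⟩
    exact h B hB.1 hB.2
  have h3 := h𝓑.basisLiminf_le_basisLimsup φ x
  exact ⟨h1.antisymm (h2.trans h3), (h3.trans h1).antisymm h2⟩

theorem IsDifferentiationBasis.exists_forall_subset (h𝓑 : IsDifferentiationBasis μ 𝓑) {x : X}
    {U : Set X} (hU : U ∈ 𝓝 x) : ∃ δ : ℝ, 0 < δ ∧ ∀ B ∈ 𝓑 x, Metric.diam B < δ → B ⊆ U := by
  obtain ⟨δ, hδ, hsub⟩ := Metric.mem_nhds_iff.1 hU
  refine ⟨δ, hδ, fun B hB hlt y hy => hsub ?_⟩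
  -- Boundedness is essential: `Metric.diam` is `0` on unbounded sets.
  exact (Metric.dist_le_diam_of_mem (h𝓑.isBounded x B hB) hy (h𝓑.mem x B hB)).trans_lt hlt

/-- Medians converge to the value of a function that is continuous at `x` relative to the complement
of a set of small density in the sets of the basis. -/
theorem IsDifferentiationBasis.hasBasisLim_median (h𝓑 : IsDifferentiationBasis μ 𝓑)
    {u : X → EReal} {x : X} {E U : Set X} (hEU : E ⊆ U) (hu : ContinuousWithinAt u Eᶜ x)
    {γ γ' : ℝ} (hγ0 : 0 ≤ γ') (hγ : γ' ≤ γ) (hγ' : γ' ≤ 1 - γ)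
    (hdens : ∀ B ∈ 𝓑 x, μ (B ∩ U) < ENNReal.ofReal γ' * μ B) :
    HasBasisLim 𝓑 (median μ γ u) x (u x) := by
  refine h𝓑.hasBasisLim (fun b hb => ?_) fun a ha => ?_
  · obtain ⟨V, hV, hVsub⟩ := mem_nhdsWithin_iff_exists_mem_nhds_inter.1
      (hu.eventually (gt_mem_nhds hb))
    obtain ⟨δ, hδ, h⟩ := h𝓑.exists_forall_subset hV
    refine ⟨δ, hδ, fun B hB hlt => median_le_coe ?_⟩
    have hsub : {y | y ∈ B ∧ (b : EReal) < u y} ⊆ B ∩ U := by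
      rintro y ⟨hy, hby⟩
      refine ⟨hy, hEU (by_contra fun hyE => ?_)⟩
      have : u y < b := hVsub ⟨h B hB hlt hy, hyE⟩
      exact this.not_gt hby
    exact (measure_mono hsub).trans_lt ((hdens B hB).trans_le (by gcongr))
  · obtain ⟨V, hV, hVsub⟩ := mem_nhdsWithin_iff_exists_mem_nhds_inter.1
      (hu.eventually (lt_mem_nhds ha))
    obtain ⟨δ, hδ, h⟩ := h𝓑.exists_forall_subset hV
    refine ⟨δ, hδ, fun B hB hlt => coe_le_median fun b hb => ?_⟩
    have hsub : B \ U ⊆ {y | y ∈ B ∧ (b : EReal) < u y} := by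
      rintro y ⟨hy, hyU⟩
      refine ⟨hy, (EReal.coe_lt_coe_iff.2 hb).trans ?_⟩
      exact hVsub ⟨h B hB hlt hy, fun hyE => hyU (hEU hyE)⟩
    -- It remains to see that `B \ U` keeps at least the fraction `1 - γ' ≥ γ` of `B`. Cancelling
    -- `γ' * μ B` requires it to be finite; if `μ B = ∞`, then `μ (B ∩ U) < ∞` forces `μ (B \ U) =
    -- ∞`.
    refine le_trans ?_ (measure_mono hsub)
    have hγ1 : 0 ≤ γ := hγ0.trans hγ
    have hdB := hdens B hB
    have hfin : ENNReal.ofReal γ' * μ B ≠ ∞ ∨ μ (B \ U) = ∞ := by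
      by_cases hB' : μ B = ∞
      · right
        by_contra hne
        have := hdB.trans_le le_top
        exact ENNReal.add_ne_top.2 ⟨this.ne, hne⟩
          (top_le_iff.1 (hB' ▸ (measure_le_inter_add_sdiff μ B U)))
      · exact Or.inl (ENNReal.mul_ne_top ENNReal.ofReal_ne_top hB')
    rcases hfin with hfin | hfin
    · refine (ENNReal.add_le_add_iff_left hfin).1 ?_
      calc ENNReal.ofReal γ' * μ B + ENNReal.ofReal γ * μ B
          = ENNReal.ofReal (γ' + γ) * μ B := by rw [ENNReal.ofReal_add hγ0 hγ1, add_mul]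
        _ ≤ 1 * μ B := by
            gcongr
            rw [← ENNReal.ofReal_one]
            exact ENNReal.ofReal_le_ofReal (by linarith)
        _ ≤ μ (B ∩ U) + μ (B \ U) := by
            rw [one_mul]
            exact measure_le_inter_add_sdiff μ B U
        _ ≤ _ := by gcongr
    · rw [hfin]
      exact le_top

/-- A function that is at least `1` on an open set has median maximal function at least `1`
there. -/
theorem IsDifferentiationBasis.one_le_medianMaximal
    (h𝓑 : IsDifferentiationBasis μ 𝓑) {v : X → EReal} {U : Set X} (hU : IsOpen U)
    (hv : ∀ x ∈ U, 1 ≤ v x) {γ : ℝ} (hγ : γ ≤ 1) {x : X} (hx : x ∈ U) :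
    1 ≤ medianMaximal μ 𝓑 γ v x := by
  obtain ⟨δ, hδ, h⟩ := h𝓑.exists_forall_subset (hU.mem_nhds hx)
  obtain ⟨B, hB, hlt⟩ := h𝓑.exists_small x δ hδ
  refine le_trans ?_ (median_le_medianMaximal (h𝓑.mem x B hB) hB)
  rw [← EReal.coe_one]
  refine coe_le_median fun b hb => ?_
  calc ENNReal.ofReal γ * μ B ≤ 1 * μ B := by
        gcongr
        exact ENNReal.ofReal_le_one.2 hγ
    _ = μ B := one_mul _
    _ ≤ _ := measure_mono ?_
  intro y hy
  exact ⟨hy, (EReal.coe_lt_coe_iff.2 hb).trans_le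
    (EReal.coe_ennreal_le_coe_ennreal_iff.2 (one_le_abs (hv y (h B hB hlt hy))))⟩

end BasisLimit

/-! ### The two implications -/

namespace HajlaszSpace

variable {X : Type*} [MetricSpace X] [MeasurableSpace X] {μ : Measure X} {F : HajlaszSpace}
  {𝓑 : X → Set (Set X)}

theorem CapacityDecay.capacityContinuity (hF : F.IsBanachRange) (h : F.CapacityDecay μ 𝓑) :
    F.CapacityContinuity μ 𝓑 := by
  intro γ hγ hγ1 t ht u hu hlim
  rw [ENNReal.tendsto_nhds_zero]
  intro ε hε
  by_contra hcon
  have hfreq : ∃ᶠ k in atTop, ε < F.capacity μ {x | (t : EReal) < medianMaximal μ 𝓑 γ (u k) x} := by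
    simpa only [Filter.Frequently, not_lt] using hcon
  obtain ⟨δ, hδ, hsum⟩ := ENNReal.exists_pos_sum_of_countable (one_ne_zero (α := ℝ≥0∞)) ℕ
  set c : ℕ → NNReal := fun n => n + 1
  have hc : ∀ n, 0 < c n := fun n => by positivity
  have hex : ∀ n, ∃ k, c n * F.norm μ (u k) ≤ δ n ∧
      ε < F.capacity μ {x | (t : EReal) < medianMaximal μ 𝓑 γ (u k) x} := by
    intro n
    have hlim' : Tendsto (fun k => c n * F.norm μ (u k)) atTop (𝓝 0) := by
      simpa using ENNReal.Tendsto.const_mul hlim (Or.inr (ENNReal.coe_ne_top (r := c n)))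
    have hev := ENNReal.tendsto_nhds_zero.1 hlim' (δ n) (ENNReal.coe_pos.2 (hδ n))
    obtain ⟨k, hk, hk'⟩ := (hfreq.and_eventually hev).exists
    exact ⟨k, hk', hk⟩
  choose k hk hcap using hex
  have hfin : ∑' n, c n * F.norm μ (u (k n)) ≠ ∞ :=
    ((ENNReal.tsum_le_tsum hk).trans_lt (hsum.trans ENNReal.one_lt_top)).ne
  obtain ⟨hW, -⟩ := Mem.tsum hF c (fun n => hu (k n)) hfin
  have hdecay := (h γ hγ hγ1 _ hW).comp
    (tendsto_natCast_atTop_atTop.atTop_mul_const ht)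
  -- The shift makes the `n`-th level `(n + 1) * t`, matching the weight `c n`.
  have hdecay' := hdecay.comp (tendsto_add_atTop_nat 1)
  obtain ⟨n, hn⟩ := (ENNReal.tendsto_nhds_zero.1 hdecay' ε hε).exists
  refine ((hcap n).trans_le (capacity_mono fun x hx => ?_)).not_ge hn
  have := mul_lt_medianMaximal (w := fun x => ((∑' n, c n * (u (k n) x).abs : ℝ≥0∞) : EReal))
    (hc n) (fun z => ?_) hx
  · simpa [c] using this
  · rw [abs_coe_ennreal]
    exact ENNReal.le_tsum (f := fun n => c n * (u (k n) z).abs) n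

theorem exists_admissible_norm_lt (hF : F.IsBanachRange) {u : X → EReal}
    (hu : F.Quasicontinuous μ u) {ε : ℝ≥0∞} (hε : 0 < ε) :
    ∃ (E : Set X) (v : X → EReal), v ∈ F.admissible μ E ∧ F.norm μ v < ε ∧ ContinuousOn u Eᶜ := by
  have hr := hF.toReal_exponent_pos
  -- Capacity is an infimum of `p`-th powers of norms, hence the threshold `ε ^ p`.
  obtain ⟨E, hE, hcont⟩ := hu (ε ^ F.exponent.toReal)
    (pos_iff_ne_zero.2 (by simp [hε.ne', hr, hr.not_gt]))
  obtain ⟨v, hv, hlt⟩ : ∃ v ∈ F.admissible μ E,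
      F.norm μ v ^ F.exponent.toReal < ε ^ F.exponent.toReal := by
    simpa only [capacity, iInf_lt_iff, exists_prop] using hE
  exact ⟨E, v, hv, (ENNReal.rpow_lt_rpow_iff hr).1 hlt, hcont⟩

theorem CapacityContinuity.medianDifferentiation (hF : F.IsBanachRange)
    (h𝓑 : IsBusemannFeller μ 𝓑) (h : F.CapacityContinuity μ 𝓑) :
    F.MedianDifferentiation μ 𝓑 := by
  intro u _ hqc
  have hex := fun k : ℕ => exists_admissible_norm_lt hF hqc (ε := ((k : ℝ≥0∞) + 1)⁻¹)
    (by simp)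
  choose E v hv hnorm hcont using hex
  choose U hU hEU hone using fun k => (hv k).2
  have hlim : Tendsto (fun k => F.norm μ (v k)) atTop (𝓝 0) := by
    refine tendsto_of_tendsto_of_tendsto_of_le_of_le tendsto_const_nhds ?_
      (fun _ => zero_le) (fun k => (hnorm k).le)
    have := ENNReal.tendsto_inv_nat_nhds_zero.comp (tendsto_add_atTop_nat 1)
    simpa [Function.comp_def] using this
  -- A countable family tending to `0` makes the exceptional set independent of `γ`; the `+ 2` keeps
  -- `θ 0 < 1`.
  set θ : ℕ → ℝ := fun j => 1 / ((j : ℝ) + 2)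
  have hθ0 : ∀ j, 0 < θ j := fun j => by positivity
  have hθ1 : ∀ j, θ j < 1 := fun j => by
    rw [div_lt_one (by positivity)]
    linarith [j.cast_nonneg (α := ℝ)]
  set N : ℕ → Set X := fun j =>
    ⋂ k, {x | ((1 / 2 : ℝ) : EReal) < medianMaximal μ 𝓑 (θ j) (v k) x}
  have hN : ∀ j, F.capacity μ (N j) = 0 := fun j => by
    have := h (θ j) (hθ0 j) (hθ1 j) (1 / 2) (by norm_num) v (fun k => (hv k).1) hlim
    exact le_antisymm (ge_of_tendsto' this fun k => capacity_mono (iInter_subset _ k)) zero_le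
  refine ⟨⋃ j, N j, capacity_iUnion_eq_zero hF hN, fun γ hγ hγ1 x hx => ?_⟩
  obtain ⟨j, hj⟩ : ∃ j : ℕ, θ j < min γ (1 - γ) := by
    obtain ⟨j, hj⟩ := exists_nat_one_div_lt (lt_min hγ (sub_pos.2 hγ1))
    refine ⟨j, lt_of_le_of_lt ?_ hj⟩
    exact one_div_le_one_div_of_le (by positivity) (by linarith)
  have hxj : x ∉ N j := fun hxj => hx (mem_iUnion.2 ⟨j, hxj⟩)
  obtain ⟨k, hk⟩ : ∃ k, medianMaximal μ 𝓑 (θ j) (v k) x ≤ ((1 / 2 : ℝ) : EReal) := by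
    simpa only [N, mem_iInter, mem_ofPred_eq, not_forall, not_lt] using hxj
  have hhalf : ∀ {a : ℝ}, 1 / 2 < a → ((1 / 2 : ℝ) : EReal) < a := fun ha =>
    EReal.coe_lt_coe_iff.2 ha
  -- On `E k ⊆ U k` the maximal function of `v k` is at least `1`, which exceeds `1 / 2`.
  have hxE : x ∈ (E k)ᶜ := fun hxE => by
    have h1 := h𝓑.toIsDifferentiationBasis.one_le_medianMaximal (hU k) (hone k) (hθ1 j).le
      (hEU k hxE)
    exact (h1.trans hk).not_gt (hhalf (by norm_num))
  refine h𝓑.toIsDifferentiationBasis.hasBasisLim_median (hEU k) (hcont k x hxE) (hθ0 j).le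
    (hj.le.trans (min_le_left _ _)) (hj.le.trans (min_le_right _ _)) fun B hB => ?_
  -- Any level strictly between `1 / 2` and `1` works: above the median, so that its superlevel set
  -- has small measure, and below the values of `|v k|` on `U k`.
  have hmed : median μ (θ j) (fun z => ((v k z).abs : EReal)) B < ((3 / 4 : ℝ) : EReal) :=
    ((median_le_medianMaximal (h𝓑.mem x B hB) hB).trans hk).trans_lt (hhalf (by norm_num))
  refine (measure_mono ?_).trans_lt (measure_lt_of_median_lt hmed)
  intro y hy
  exact ⟨hy.1, (EReal.coe_lt_coe_iff.2 (by norm_num : (3 / 4 : ℝ) < 1)).trans_le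
    (EReal.coe_ennreal_le_coe_ennreal_iff.2 (one_le_abs (hone k y hy.2)))⟩

end HajlaszSpace

end MedianDiff

theorem theoremM {X : Type*} [MetricSpace X] [TopologicalSpace.SeparableSpace X]
    [MeasurableSpace X] [BorelSpace X]
    (μ : MeasureTheory.Measure X) (hμ : MedianDiff.BallsPosFinite μ)
    (𝓑 : X → Set (Set X)) (h𝓑 : MedianDiff.IsBusemannFeller μ 𝓑)
    (F : MedianDiff.HajlaszSpace)
    (hF : (∃ (s : ℝ) (p q : ℝ≥0∞), 0 < s ∧ s < 1 ∧ 1 < p ∧ p < ∞ ∧ 1 < q ∧ q < ∞ ∧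
            (F = .besov s p q ∨ F = .triebelLizorkin s p q)) ∨
          (∃ (s : ℝ) (p : ℝ≥0∞), 0 < s ∧ s ≤ 1 ∧ 1 < p ∧ p < ∞ ∧
            (F = .triebelLizorkin s p ∞ ∨ F = .hajlasz s p))) :
    (F.CapacityDecay μ 𝓑 → F.CapacityContinuity μ 𝓑) ∧
      (F.CapacityContinuity μ 𝓑 → F.MedianDifferentiation μ 𝓑) := by
  have hrange : F.IsBanachRange := by
    rcases hF with ⟨s, p, q, -, -, hp, hp', hq, -, rfl | rfl⟩ | ⟨s, p, -, -, hp, hp', rfl | rfl⟩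
    · exact ⟨hp.le, hp'.ne, hq.le⟩
    · exact ⟨hp.le, hp'.ne, hq.le⟩
    · exact ⟨hp.le, hp'.ne, le_top⟩
    · exact ⟨hp.le, hp'.ne⟩
  exact ⟨fun h => h.capacityContinuity hrange, fun h => h.medianDifferentiation hrange h𝓑⟩
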